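/- Let $n,q,r,k\ge 0$ be integers with $k<n$. Identify the fibre of the jet bundle $J^r(\mathbb R^n,\mathbb R^q)\to\mathbb R^n$ over each point with the space of families $(p_0,\dots,p_r)$ of symmetric $i$-linear maps $p_i:(\mathbb R^n)^i\to\mathbb R^q$, with any fixed norm (say the maximum of the operator norms), so that the $r$-jet of $f$ at $x$ is $J^r_f(x)=(f(x),Df(x),\dots,D^rf(x))$. A section of $J^r(\mathbb R^n,\mathbb R^q)$ over an open set $V$ is called holonomic if it equals $J^r_f$ for some $C^\infty$ map $f:V\to\mathbb R^q$. Let $$I^k=\{x\in\mathbb R^n:\ 0\le x_i\le 1 \text{ for } i\le k,\ x_i=0\text{ for } i>k\},$$ and let $\partial I^k$ be its boundary, i.e. the set of those $x\in I^k$ with $x_i\in\{0,1\}$ for some $i\le k$. Both $I^k$ and $\partial I^k$ are also regarded as subsets of $\mathbb R^k$, the space of the first $k$ coordinates. Let $F$ be a continuous section of $J^r(\mathbb R^n,\mathbb R^q)$ over an open neighbourhood $U$ of $I^k$ in $\mathbb R^n$, and suppose that $F$ is holonomic over some open neighbourhood of $\partial I^k$. Then for all $\delta,\varepsilon>0$ there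 exist a $C^\infty$ function $\varphi:\mathbb R^k\to\mathbb R$ such that $$h(x_1,\dots,x_n)=(x_1,\dots,x_{n-1},\,x_n+\varphi(x_1,\dots,x_k))$$ is a $C^\infty$ diffeomorphism $h:\mathbb R^n\to\mathbb R^n$, an open neighbourhood $W$ of $h(I^k)$, and a holonomic section $\widetilde F$ of $J^r(\mathbb R^n,\mathbb R^q)$ over $W$, such that - $|\varphi|<\delta$ on $\mathbb R^k$, and $\varphi=0$ on a neighbourhood of $\partial I^k$ in $\mathbb R^k$; - $h(I^k)\subset W\subset U$; in particular $h(I^k)$ lies in the domain of $F$; - $\widetilde F=F$ on a neighbourhood of $\partial I^k$ in $\mathbb R^n$; - $\|\widetilde F-F\|_{C^0(W)}=\sup_{x\in W}\|\widetilde F(x)-F(x)\|<\varepsilon$. -/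

import Mathlib

open scoped Manifold ContDiff Topology

namespace HolonomicApprox

/-- Families `(p_0, …, p_r)` where `p_i` is an `i`-linear map on `ℝⁿ` with values in `ℝ^q`,
with the maximum of the operator norms. -/
abbrev PreJet (n q r : ℕ) : Type :=
  (i : Fin (r + 1)) →
    ContinuousMultilinearMap ℝ (fun _ : Fin (i : ℕ) => EuclideanSpace ℝ (Fin n))
      (EuclideanSpace ℝ (Fin q))

/-- The fibre of the jet bundle `J^r(ℝⁿ, ℝ^q) → ℝⁿ`: families `(p_0, …, p_r)` of *symmetric*
`i`-linear maps, `p_i` standing for the `i`-th derivative. The bundle is trivial, so its sections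
over a set `U` are the maps from `U` to this normed space. -/
def JetFiber (n q r : ℕ) : Submodule ℝ (PreJet n q r) where
  carrier := {p | ∀ (i : Fin (r + 1)) (σ : Equiv.Perm (Fin (i : ℕ)))
    (v : Fin (i : ℕ) → EuclideanSpace ℝ (Fin n)), p i (fun j => v (σ j)) = p i v}
  add_mem' := by
    intro a b ha hb i σ v
    simp only [Pi.add_apply, add_apply, ha i σ v, hb i σ v]
  zero_mem' := by
    intro i σ v
    simp
  smul_mem' := by
    intro c a ha i σ v
    simp only [Pi.smul_apply, smul_apply, ha i σ v]

/-- The `r`-jet `(f(x), Df(x), …, D^r f(x))` of a map `f : ℝⁿ → ℝ^q` at `x`. -/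
noncomputable def jet {n q : ℕ} (r : ℕ)
    (f : EuclideanSpace ℝ (Fin n) → EuclideanSpace ℝ (Fin q))
    (x : EuclideanSpace ℝ (Fin n)) : PreJet n q r :=
  fun i => iteratedFDeriv ℝ (i : ℕ) f x

/-- The iterated derivative of a `C^∞` map is invariant under exchanging adjacent arguments. -/
theorem iteratedFDeriv_comp_swap {E G : Type*} [NormedAddCommGroup E] [NormedSpace ℝ E]
    [NormedAddCommGroup G] [NormedSpace ℝ G] {f : E → G} {V : Set E} (hV : IsOpen V)
    (hfV : ContDiffOn ℝ ∞ f V) (m : ℕ) :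
    ∀ x ∈ V, ∀ (i : Fin m) (v : Fin (m + 1) → E),
      iteratedFDeriv ℝ (m + 1) f x (fun j => v (Equiv.swap i.castSucc i.succ j)) =
        iteratedFDeriv ℝ (m + 1) f x v := by
  induction m with
  | zero => intro x _ i; exact i.elim0
  | succ m ih =>
    intro x hx i v
    have hle : ∀ l : ℕ, (l : ℕ∞ω) ≤ ∞ := fun l => by
      exact_mod_cast (le_top : (l : ℕ∞) ≤ ⊤)
    have hf : ContDiffAt ℝ ∞ f x := hfV.contDiffAt (hV.mem_nhds hx)
    have hd : ∀ (l : ℕ) (w : Fin l → E) (a : E),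
        fderiv ℝ (iteratedFDeriv ℝ l f) x a w =
          fderiv ℝ (fun y => iteratedFDeriv ℝ l f y w) x a := by
      intro l w a
      have h1 : ContDiffAt ℝ 1 (iteratedFDeriv ℝ l f) x :=
        hf.iteratedFDeriv_right
          (by exact_mod_cast hle (1 + l))
      have h2 : HasFDerivAt (iteratedFDeriv ℝ l f) (fderiv ℝ (iteratedFDeriv ℝ l f) x) x :=
        (h1.differentiableAt one_ne_zero).hasFDerivAt
      have h3 := (ContinuousMultilinearMap.apply ℝ (fun _ : Fin l => E) G w).hasFDerivAt.comp x h2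
      have h4 := h3.fderiv
      have h5 : (fun y => iteratedFDeriv ℝ l f y w) =
          (ContinuousMultilinearMap.apply ℝ (fun _ : Fin l => E) G w) ∘ iteratedFDeriv ℝ l f := rfl
      rw [h5, h4]
      rfl
    refine Fin.cases ?_ (fun i => ?_) i
    · have key : ∀ w : Fin (m + 2) → E, iteratedFDeriv ℝ (m + 2) f x w =
          fderiv ℝ (fderiv ℝ (iteratedFDeriv ℝ m f)) x (w 0) (w 1) (Fin.tail (Fin.tail w)) := by
        intro w
        rw [iteratedFDeriv_succ_apply_left, hd]
        have h1 : ContDiffAt ℝ 1 (fderiv ℝ (iteratedFDeriv ℝ m f)) x :=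
          (hf.iteratedFDeriv_right (i := m) (m := 2)
          (by exact_mod_cast hle (2 + m))).fderiv_right
            (by norm_num)
        have h2 := (h1.differentiableAt one_ne_zero).hasFDerivAt
        have h3 := (ContinuousMultilinearMap.apply ℝ (fun _ : Fin m => E) G
          (Fin.tail (Fin.tail w))).hasFDerivAt.comp x
            ((ContinuousLinearMap.apply ℝ _ (w 1)).hasFDerivAt.comp x h2)
        have h5 : (fun y => iteratedFDeriv ℝ (m + 1) f y (Fin.tail w)) =
          (ContinuousMultilinearMap.apply ℝ (fun _ : Fin m => E) G (Fin.tail (Fin.tail w))) ∘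
            ((ContinuousLinearMap.apply ℝ _ (w 1)) ∘ (fderiv ℝ (iteratedFDeriv ℝ m f))) := rfl
        rw [h5, h3.fderiv]
        rfl
      have hsymm : IsSymmSndFDerivAt ℝ (iteratedFDeriv ℝ m f) x :=
        (hf.iteratedFDeriv_right (i := m) (m := 2)
          (by exact_mod_cast hle (2 + m))).isSymmSndFDerivAt
          (by simp)
      rw [key, key]
      have e0 : Equiv.swap (Fin.castSucc (0 : Fin (m + 1))) (Fin.succ 0) 0 = 1 := by simp
      have e1 : Equiv.swap (Fin.castSucc (0 : Fin (m + 1))) (Fin.succ 0) 1 = 0 := by simp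
      have e2 : Fin.tail (Fin.tail
          (fun j => v (Equiv.swap (Fin.castSucc (0 : Fin (m + 1))) (Fin.succ 0) j))) =
            Fin.tail (Fin.tail v) := by
        funext j
        simp only [Fin.tail]
        rw [Equiv.swap_apply_of_ne_of_ne]
        · simp [Fin.ext_iff]
        · simp [Fin.ext_iff]
      rw [e0, e1, e2, hsymm.eq]
    · rw [iteratedFDeriv_succ_apply_left, iteratedFDeriv_succ_apply_left, hd, hd]
      have e0 : Equiv.swap (Fin.castSucc i.succ) (Fin.succ i.succ) 0 = 0 := by
        rw [Equiv.swap_apply_of_ne_of_ne] <;> simp [Fin.ext_iff]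
      have e1 : Fin.tail (fun j => v (Equiv.swap (Fin.castSucc i.succ) (Fin.succ i.succ) j)) =
          fun j => Fin.tail v (Equiv.swap i.castSucc i.succ j) := by
        funext j
        simp only [Fin.tail]
        congr 1
        simp only [Equiv.swap_apply_def, ← Fin.succ_castSucc, Fin.succ_inj]
        split_ifs <;> rfl
      have hev : (fun y => iteratedFDeriv ℝ (m + 1) f y
            (Fin.tail (fun j => v (Equiv.swap (Fin.castSucc i.succ) (Fin.succ i.succ) j)))) =ᶠ[𝓝 x]
          fun y => iteratedFDeriv ℝ (m + 1) f y (Fin.tail v) := by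
        filter_upwards [hV.mem_nhds hx] with y hy
        rw [e1]
        exact ih y hy i _
      rw [e0, hev.fderiv_eq]

/-- The jet of a smooth map lies in the fibre of the jet bundle. -/
theorem jet_mem_jetFiber {n q : ℕ} (r : ℕ)
    {f : EuclideanSpace ℝ (Fin n) → EuclideanSpace ℝ (Fin q)}
    {V : Set (EuclideanSpace ℝ (Fin n))} (hV : IsOpen V) (hf : ContDiffOn ℝ ∞ f V)
    {x : EuclideanSpace ℝ (Fin n)} (hx : x ∈ V) : jet r f x ∈ JetFiber n q r := by
  intro i
  change ∀ (σ : Equiv.Perm (Fin (i : ℕ))) (v : Fin (i : ℕ) → EuclideanSpace ℝ (Fin n)),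
    iteratedFDeriv ℝ (i : ℕ) f x (fun j => v (σ j)) = iteratedFDeriv ℝ (i : ℕ) f x v
  generalize (i : ℕ) = m
  cases m with
  | zero =>
    intro σ v
    congr 1
    funext j
    exact j.elim0
  | succ m =>
    intro σ
    have hσ : σ ∈ Submonoid.closure
        (Set.range fun i : Fin m => Equiv.swap i.castSucc i.succ) := by
      rw [Equiv.Perm.mclosure_swap_castSucc_succ]
      exact Submonoid.mem_top _
    induction hσ using Submonoid.closure_induction with
    | mem τ hτ =>
      obtain ⟨i, rfl⟩ := hτ
      exact iteratedFDeriv_comp_swap hV hf m x hx i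
    | one => intro v; rfl
    | mul a b _ _ ha hb =>
      intro v
      have h1 := hb (fun j => v (a j))
      exact h1.trans (ha v)

/-- The section `F` is holonomic over the open set `V`: there it is the `r`-jet extension of a
`C^∞` map `f : V → ℝ^q`. Values of `F` and `f` off `V` play no role. -/
def IsHolonomicOn {n q r : ℕ} (F : EuclideanSpace ℝ (Fin n) → JetFiber n q r)
    (V : Set (EuclideanSpace ℝ (Fin n))) : Prop :=
  IsOpen V ∧ ∃ f : EuclideanSpace ℝ (Fin n) → EuclideanSpace ℝ (Fin q),
    ContDiffOn ℝ ∞ f V ∧ ∀ x ∈ V, (F x : PreJet n q r) = jet r f x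

/-- The unit cube `I^k = [0,1]^k × {0}` in the subspace of the first `k` coordinates of `ℝⁿ`. -/
def cube (n k : ℕ) : Set (EuclideanSpace ℝ (Fin n)) :=
  {x | ∀ i : Fin n, ((i : ℕ) < k → x i ∈ Set.Icc (0 : ℝ) 1) ∧ (k ≤ (i : ℕ) → x i = 0)}

/-- The boundary `∂I^k` of the unit cube, as a subset of `ℝⁿ`. -/
def cubeBoundary (n k : ℕ) : Set (EuclideanSpace ℝ (Fin n)) :=
  {x | x ∈ cube n k ∧ ∃ i : Fin n, (i : ℕ) < k ∧ (x i = 0 ∨ x i = 1)}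

/-- The projection `(x_1, …, x_n) ↦ (x_1, …, x_k)`. -/
noncomputable def firstCoords {n k : ℕ} (hk : k ≤ n) (x : EuclideanSpace ℝ (Fin n)) :
    EuclideanSpace ℝ (Fin k) :=
  WithLp.toLp 2 (fun j : Fin k => x (Fin.castLE hk j))

/-- The map `(x_1, …, x_n) ↦ (x_1, …, x_{n-1}, x_n + φ(x_1, …, x_k))`. -/
noncomputable def shear {n k : ℕ} (hk : k ≤ n) (φ : EuclideanSpace ℝ (Fin k) → ℝ)
    (x : EuclideanSpace ℝ (Fin n)) : EuclideanSpace ℝ (Fin n) :=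
  WithLp.toLp 2 (fun i : Fin n => if (i : ℕ) + 1 = n then x i + φ (firstCoords hk x) else x i)

end HolonomicApprox

/-! At a single point a section is matched by the jet of a Taylor polynomial, so over the cube there
is a family of smooth maps, one per centre, each good only near its centre
(`exists_fiberedApprox_zero`). Near the boundary all of them are replaced by one map `f₀` whose jet
is `F` there.

The parameters are removed one coordinate at a time (`FiberedApprox.step`). Only discretely many
values of the coordinate are kept: even and odd multiples of `1 / M`. A cutoff `ψ` in the spare
direction `x_n`, which exists since `k < n`, blends the nearest even map (above) with the nearest
odd one (below). Each choice jumps midway between its centres. The cube is therefore bent into a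
wave whose crests lie at even multiples and troughs at odd ones, so that every jump occurs where the
jumping map has weight zero.

The amplitude of the wave, hence `ψ` and the cost of multiplying jets by it, is fixed before the
frequency `M`. Raising `M` makes the two blended maps as close as desired at no extra cost. After
`k` steps no parameter is left. -/

namespace HolonomicApprox

/-! ### Jets: Leibniz bound, dependence on parameters, Taylor polynomials. -/

section Jets

variable {n q r : ℕ}

local notation "E" => EuclideanSpace ℝ (Fin n)
local notation "G" => EuclideanSpace ℝ (Fin q)

theorem natCast_le_infty (l : ℕ) : (l : ℕ∞ω) ≤ ∞ := by
  exact_mod_cast (le_top : (l : ℕ∞) ≤ ⊤)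

theorem jet_congr {f g : E → G} {x : E} (h : f =ᶠ[𝓝 x] g) : jet r f x = jet r g x :=
  funext fun i => (h.iteratedFDeriv ℝ (i : ℕ)).eq_of_nhds

theorem jet_add {f g : E → G} {x : E} (hf : ContDiffAt ℝ ∞ f x) (hg : ContDiffAt ℝ ∞ g x) :
    jet r (fun y => f y + g y) x = jet r f x + jet r g x :=
  funext fun i => iteratedFDeriv_add_apply (hf.of_le (natCast_le_infty i))
    (hg.of_le (natCast_le_infty i))

theorem jet_const_smul {f : E → G} {x : E} (hf : ContDiffAt ℝ ∞ f x) (c : ℝ) :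
    jet r (fun y => c • f y) x = c • jet r f x :=
  funext fun i => iteratedFDeriv_const_smul_apply' (a := c) (hf.of_le (natCast_le_infty i))

theorem jet_sub {f g : E → G} {x : E} (hf : ContDiffAt ℝ ∞ f x) (hg : ContDiffAt ℝ ∞ g x) :
    jet r (fun y => f y - g y) x = jet r f x - jet r g x := by
  have h := jet_add (r := r) (hf.sub hg) hg
  simp only [sub_add_cancel] at h
  rw [h, add_sub_cancel_right]

/-- On a compact set, multiplication by a smooth function is bounded on jets. -/
theorem exists_norm_jet_smul_le (r : ℕ) {ψ : E → ℝ} (hψ : ContDiff ℝ ∞ ψ) {B : Set E}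
    (hB : IsCompact B) :
    ∃ C : ℝ, 0 ≤ C ∧ ∀ x ∈ B, ∀ f : E → G, ContDiffAt ℝ ∞ f x →
      ‖jet r (fun y => ψ y • f y) x‖ ≤ C * ‖jet r f x‖ := by
  have hc : ∀ i : ℕ, ∃ C : ℝ, ∀ x ∈ B, ‖iteratedFDeriv ℝ i ψ x‖ ≤ C := fun i =>
    hB.exists_bound_of_continuousOn (hψ.continuous_iteratedFDeriv (natCast_le_infty i)).continuousOn
  choose c hc using hc
  refine ⟨∑ i ∈ Finset.range (r + 1), ∑ l ∈ Finset.range (i + 1), (i.choose l : ℝ) * |c l|,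
    by positivity, fun x hx f hf => ?_⟩
  rw [pi_norm_le_iff_of_nonneg (by positivity)]
  intro i
  have hi : (i : ℕ) ∈ Finset.range (r + 1) := Finset.mem_range.2 i.2
  obtain ⟨u, hu, hfu⟩ := hf.contDiffOn (natCast_le_infty i) (by simp)
  obtain ⟨v, hvu, hv, hxv⟩ := mem_nhds_iff.1 hu
  have h1 := norm_iteratedFDerivWithin_smul_le (𝕜 := ℝ)
    (hψ.of_le (natCast_le_infty i)).contDiffOn (hfu.mono hvu) hv.uniqueDiffOn hxv
    (le_refl ((i : ℕ) : ℕ∞ω))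
  simp only [iteratedFDerivWithin_of_isOpen _ hv hxv] at h1
  refine h1.trans ?_
  rw [Finset.sum_mul]
  refine le_trans ?_ (Finset.single_le_sum (fun i _ => by positivity) hi)
  rw [Finset.sum_mul]
  refine Finset.sum_le_sum fun l hl => ?_
  have h2 : ‖iteratedFDeriv ℝ ((i : ℕ) - l) f x‖ ≤ ‖jet r f x‖ :=
    norm_le_pi_norm (jet r f x) ⟨(i : ℕ) - l, by omega⟩
  have h3 : ‖iteratedFDeriv ℝ l ψ x‖ ≤ |c l| := (hc l x hx).trans (le_abs_self _)
  gcongr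

/-- Joint regularity in parameter and point lets compactness yield the uniform estimates of the
initial family. -/
theorem contDiff_iteratedFDeriv_param {P X Y : Type*} [NormedAddCommGroup P] [NormedSpace ℝ P]
    [NormedAddCommGroup X] [NormedSpace ℝ X] [NormedAddCommGroup Y] [NormedSpace ℝ Y]
    {Q : P → X → Y} (hQ : ContDiff ℝ ∞ (Function.uncurry Q)) (i : ℕ) :
    ContDiff ℝ ∞ (fun z : P × X => iteratedFDeriv ℝ i (Q z.1) z.2) := by
  induction i with
  | zero =>
    exact (continuousMultilinearCurryFin0 ℝ X Y).symm.contDiff.comp hQ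
  | succ i ih =>
    have h : ContDiff ℝ ∞ (fun z : P × X => fderiv ℝ (iteratedFDeriv ℝ i (Q z.1)) z.2) := by
      refine ContDiff.fderiv (f := fun z : P × X => iteratedFDeriv ℝ i (Q z.1)) (m := ∞) ?_
        contDiff_snd (by simp)
      exact ih.comp ((contDiff_fst.comp contDiff_fst).prodMk contDiff_snd)
    exact (continuousMultilinearCurryLeftEquiv ℝ (fun _ : Fin (i + 1) => X) Y).symm.contDiff.comp h

theorem continuous_jet_param {P : Type*} [NormedAddCommGroup P] [NormedSpace ℝ P]
    {Q : P → E → G} (hQ : ContDiff ℝ ∞ (Function.uncurry Q)) :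
    Continuous (fun z : P × E => jet r (Q z.1) z.2) :=
  continuous_pi fun i => (contDiff_iteratedFDeriv_param hQ i).continuous

/-- The Taylor polynomial at `z` with prescribed jet `p`. -/
noncomputable def taylorPoly (p : PreJet n q r) (z x : E) : G :=
  ∑ i : Fin (r + 1), ((Nat.factorial i : ℝ)⁻¹) • p i (fun _ => x - z)

theorem contDiff_taylorPoly :
    ContDiff ℝ ∞ (fun w : (PreJet n q r × E) × E => taylorPoly w.1.1 w.1.2 w.2) := by
  unfold taylorPoly
  refine ContDiff.sum fun i _ => ContDiff.const_smul _ ?_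
  have h : ContDiff ℝ ∞ (fun w : PreJet n q r × (Fin (i : ℕ) → E) => w.1 i w.2) :=
    (AnalyticOnNhd.contDiff (ContinuousLinearMap.analyticOnNhd_uncurry_of_multilinear
      (ContinuousLinearMap.proj (R := ℝ) (φ := fun i : Fin (r + 1) =>
        ContinuousMultilinearMap ℝ (fun _ : Fin (i : ℕ) => E) G) i)) :)
  exact h.comp (f := fun w : (PreJet n q r × E) × E => (w.1.1, fun _ : Fin (i : ℕ) => w.2 - w.1.2))
    (by fun_prop)

/-- The `i`-th derivative of the series at its centre is a sum over permutations of the arguments.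
By symmetry of `p i` its `i!` terms coincide and cancel the factor `1 / i!`. -/
theorem jet_taylorPoly {p : PreJet n q r} (hp : p ∈ JetFiber n q r) (z : E) :
    jet r (taylorPoly p z) z = p := by
  let s : FormalMultilinearSeries ℝ E G := fun m =>
    if h : m < r + 1 then ((Nat.factorial m : ℝ)⁻¹) • p ⟨m, h⟩ else 0
  have hs : HasFiniteFPowerSeriesOnBall (taylorPoly p z) s z (r + 1) ⊤ := by
    refine HasFiniteFPowerSeriesOnBall.mk' (fun m hm => dif_neg (by omega)) (by simp)
      fun y _ => ?_
    rw [Finset.sum_range]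
    exact Finset.sum_congr rfl fun i _ => by
      rw [show s i = _ from dif_pos i.2, add_sub_cancel_left]; rfl
  funext i
  ext v : 1
  change iteratedFDeriv ℝ (i : ℕ) (taylorPoly p z) z v = _
  rw [hs.toHasFPowerSeriesOnBall.iteratedFDeriv_eq_sum_of_completeSpace]
  have h1 : s i = ((Nat.factorial i : ℝ)⁻¹) • p i := dif_pos i.2
  have hfac : (Nat.factorial i : ℝ) ≠ 0 := by positivity
  simp only [h1, _root_.smul_apply, hp i]
  rw [Finset.sum_const, Finset.card_univ, Fintype.card_perm, Fintype.card_fin,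
    ← Nat.cast_smul_eq_nsmul ℝ, smul_smul, mul_inv_cancel₀ hfac, one_smul]

end Jets

end HolonomicApprox

namespace HolonomicApprox

/-! ### Nearest even and odd multiples of `1 / N`. -/

section Rounding

theorem eventually_round_eq {t : ℝ} (ht : ∀ m : ℤ, t ≠ m + 1 / 2) :
    ∀ᶠ s in 𝓝 t, round s = round t := by
  have h1 : (⌊t + 1 / 2⌋ : ℝ) < t + 1 / 2 := by
    refine lt_of_le_of_ne (Int.floor_le _) fun h => ht (⌊t + 1 / 2⌋ - 1) ?_
    push_cast
    linarith
  have h2 := Int.lt_floor_add_one (t + 1 / 2)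
  filter_upwards [Ioo_mem_nhds (a := (⌊t + 1 / 2⌋ : ℝ) - 1 / 2) (b := (⌊t + 1 / 2⌋ : ℝ) + 1 / 2)
    (by linarith) (by linarith)] with s hs
  obtain ⟨hs1, hs2⟩ := hs
  rw [round_eq, round_eq, Int.floor_eq_iff]
  constructor <;> linarith

/-- An even multiple of `1 / N` nearest to `t`. -/
noncomputable def nearEven (N : ℕ) (t : ℝ) : ℝ := 2 * round (N * t / 2) / N

/-- An odd multiple of `1 / N` nearest to `t`. -/
noncomputable def nearOdd (N : ℕ) (t : ℝ) : ℝ := (2 * round ((N * t - 1) / 2) + 1) / N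

variable {N : ℕ}

theorem abs_sub_nearEven_le (hN : 0 < N) (t : ℝ) : |t - nearEven N t| ≤ 1 / N := by
  have hN' : (0 : ℝ) < N := by exact_mod_cast hN
  have h : t - nearEven N t = 2 * (N * t / 2 - round (N * t / 2)) / N := by
    unfold nearEven
    field_simp
  rw [h, abs_div, abs_mul, abs_of_pos hN', abs_two]
  gcongr
  linarith [abs_sub_round (N * t / 2)]

theorem abs_sub_nearOdd_le (hN : 0 < N) (t : ℝ) : |t - nearOdd N t| ≤ 1 / N := by
  have hN' : (0 : ℝ) < N := by exact_mod_cast hN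
  have h : t - nearOdd N t = 2 * ((N * t - 1) / 2 - round ((N * t - 1) / 2)) / N := by
    unfold nearOdd
    field_simp
    ring
  rw [h, abs_div, abs_mul, abs_of_pos hN', abs_two]
  gcongr
  linarith [abs_sub_round ((N * t - 1) / 2)]

/-- Rounding to even multiples jumps only at odd multiples, which are the troughs of the cosine wave
used for the shift. -/
theorem eventually_nearEven_eq {t : ℝ} (ht : Real.cos (N * t * Real.pi) ≠ -1) :
    ∀ᶠ s in 𝓝 t, nearEven N s = nearEven N t := by
  have h := eventually_round_eq (t := N * t / 2) fun m hm => ht (by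
    rw [show N * t * Real.pi = Real.pi + m * (2 * Real.pi) by
      rw [show N * t = 2 * (m + 1 / 2) by linarith]; ring]
    rw [Real.cos_add_int_mul_two_pi, Real.cos_pi])
  have hc : Continuous fun s : ℝ => N * s / 2 := by fun_prop
  filter_upwards [(hc.tendsto t).eventually h] with s hs
  rw [nearEven, nearEven, hs]

theorem eventually_nearOdd_eq {t : ℝ} (ht : Real.cos (N * t * Real.pi) ≠ 1) :
    ∀ᶠ s in 𝓝 t, nearOdd N s = nearOdd N t := by
  have h := eventually_round_eq (t := (N * t - 1) / 2) fun m hm => ht (by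
    rw [show N * t * Real.pi = 0 + (m + 1 : ℤ) * (2 * Real.pi) by
      rw [show N * t = 2 * (m + 1) by linarith]; push_cast; ring]
    rw [Real.cos_add_int_mul_two_pi, Real.cos_zero])
  have hc : Continuous fun s : ℝ => (N * s - 1) / 2 := by fun_prop
  filter_upwards [(hc.tendsto t).eventually h] with s hs
  rw [nearOdd, nearOdd, hs]

end Rounding

/-! ### Neighbourhoods of the faces and of the sheared cube. -/

section Tubes

variable {n k : ℕ}

/-- Some one of the first `k` coordinates of `x` is smaller than `ρ` or larger than `1 - ρ`. -/
def NearFace (k : ℕ) (ρ : ℝ) (x : EuclideanSpace ℝ (Fin n)) : Prop :=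
  ∃ i : Fin n, (i : ℕ) < k ∧ (x i < ρ ∨ 1 - ρ < x i)

theorem NearFace.mono {ρ ρ' : ℝ} (h : ρ ≤ ρ') {x : EuclideanSpace ℝ (Fin n)}
    (hx : NearFace k ρ x) : NearFace k ρ' x := by
  obtain ⟨i, hi, hx⟩ := hx
  exact ⟨i, hi, hx.imp (fun h' => by linarith) (fun h' => by linarith)⟩

theorem isOpen_nearFace (k : ℕ) (ρ : ℝ) :
    IsOpen {x : EuclideanSpace ℝ (Fin n) | NearFace k ρ x} := by
  simp only [NearFace, Set.ofPred_exists, Set.ofPred_and, Set.ofPred_or]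
  refine isOpen_iUnion fun i => isOpen_const.inter (IsOpen.union ?_ ?_)
  · exact isOpen_lt (by fun_prop) continuous_const
  · exact isOpen_lt continuous_const (by fun_prop)

theorem nearFace_firstCoords (hk : k ≤ n) {ρ : ℝ} {x : EuclideanSpace ℝ (Fin n)} :
    NearFace k ρ (firstCoords hk x) ↔ NearFace k ρ x := by
  constructor
  · rintro ⟨i, hi, h⟩
    exact ⟨Fin.castLE hk i, hi, h⟩
  · rintro ⟨i, hi, h⟩
    exact ⟨⟨i, hi⟩, hi, h⟩

/-- A smooth cutoff which vanishes near the faces of the unit cube. -/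
theorem exists_cubeCutoff (k : ℕ) {ρ : ℝ} (hρ : 0 < ρ) :
    ∃ β : EuclideanSpace ℝ (Fin k) → ℝ, ContDiff ℝ ∞ β ∧ (∀ v, |β v| ≤ 1) ∧
      (∀ v, NearFace k (ρ / 4) v → β v = 0) ∧ ∀ v, ¬ NearFace k (ρ / 2) v → β v = 1 := by
  let b : ℝ → ℝ := fun t => Real.smoothTransition ((t - ρ / 4) / (ρ / 4)) *
    Real.smoothTransition ((1 - ρ / 4 - t) / (ρ / 4))
  have hb : ContDiff ℝ ∞ b := by
    refine ContDiff.mul (Real.smoothTransition.contDiff.comp ?_)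
      (Real.smoothTransition.contDiff.comp ?_) <;> fun_prop
  have hb0 : ∀ t, 0 ≤ b t := fun t =>
    mul_nonneg (Real.smoothTransition.nonneg _) (Real.smoothTransition.nonneg _)
  have hb1 : ∀ t, b t ≤ 1 := fun t =>
    mul_le_one₀ (Real.smoothTransition.le_one _) (Real.smoothTransition.nonneg _)
      (Real.smoothTransition.le_one _)
  refine ⟨fun v => ∏ i, b (v i), contDiff_prod fun i _ => hb.comp (by fun_prop), fun v => ?_,
    fun v => ?_, fun v hv => ?_⟩
  · rw [abs_of_nonneg (Finset.prod_nonneg fun i _ => hb0 _)]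
    exact Finset.prod_le_one (fun i _ => hb0 _) fun i _ => hb1 _
  · rintro ⟨i, -, h⟩
    refine Finset.prod_eq_zero (Finset.mem_univ i) ?_
    rcases h with h | h
    · refine mul_eq_zero_of_left (Real.smoothTransition.zero_of_nonpos ?_) _
      exact div_nonpos_of_nonpos_of_nonneg (by linarith) (by linarith)
    · refine mul_eq_zero_of_right _ (Real.smoothTransition.zero_of_nonpos ?_)
      exact div_nonpos_of_nonpos_of_nonneg (by linarith) (by linarith)
  · refine Finset.prod_eq_one fun i _ => ?_
    simp only [NearFace, not_exists, not_and, not_or, not_lt] at hv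
    obtain ⟨h1, h2⟩ := hv i i.2
    simp only [b]
    rw [Real.smoothTransition.one_of_one_le, Real.smoothTransition.one_of_one_le, one_mul]
    · rw [le_div_iff₀ (by positivity)]; linarith
    · rw [le_div_iff₀ (by positivity)]; linarith

/-- The points which the shear by `-φ` moves into the open `ρ`-box around the unit cube. -/
def tube (hk : k < n) (φ : EuclideanSpace ℝ (Fin k) → ℝ) (ρ : ℝ) :
    Set (EuclideanSpace ℝ (Fin n)) :=
  {x | (∀ i : Fin n, (i : ℕ) < k → -ρ < x i ∧ x i < 1 + ρ) ∧
    (∀ i : Fin n, k ≤ (i : ℕ) → (i : ℕ) + 1 ≠ n → |x i| < ρ) ∧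
    |x ⟨n - 1, by omega⟩ - φ (firstCoords hk.le x)| < ρ}

theorem contDiff_firstCoords (hk : k ≤ n) : ContDiff ℝ ∞ (firstCoords (n := n) hk) := by
  rw [contDiff_euclidean]
  intro i
  simp only [firstCoords]
  fun_prop

theorem isOpen_tube (hk : k < n) {φ : EuclideanSpace ℝ (Fin k) → ℝ} (hφ : Continuous φ) (ρ : ℝ) :
    IsOpen (tube hk φ ρ) := by
  have hc := (contDiff_firstCoords (n := n) hk.le).continuous
  simp only [tube, Set.ofPred_and, Set.ofPred_forall]
  refine IsOpen.inter ?_ (IsOpen.inter ?_ ?_)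
  · refine isOpen_iInter_of_finite fun i => isOpen_iInter_of_finite fun _ => IsOpen.inter ?_ ?_
    · exact isOpen_lt continuous_const (by fun_prop)
    · exact isOpen_lt (by fun_prop) continuous_const
  · refine isOpen_iInter_of_finite fun i => isOpen_iInter_of_finite fun _ =>
      isOpen_iInter_of_finite fun _ => isOpen_lt (by fun_prop) continuous_const
  · exact isOpen_lt (by fun_prop) continuous_const

/-- The part of the tube over which the coordinates `j ≤ i < k` are `ρ`-close to those of `y`. -/
def subtube (hk : k < n) (φ : EuclideanSpace ℝ (Fin k) → ℝ) (ρ : ℝ) (j : ℕ) (y : Fin n → ℝ) :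
    Set (EuclideanSpace ℝ (Fin n)) :=
  {x | x ∈ tube hk φ ρ ∧ ∀ i : Fin n, j ≤ (i : ℕ) → (i : ℕ) < k → |x i - y i| < ρ}

theorem isOpen_subtube (hk : k < n) {φ : EuclideanSpace ℝ (Fin k) → ℝ} (hφ : Continuous φ)
    (ρ : ℝ) (j : ℕ) (y : Fin n → ℝ) : IsOpen (subtube hk φ ρ j y) := by
  simp only [subtube, Set.ofPred_and, Set.ofPred_forall]
  refine (isOpen_tube hk hφ ρ).inter ?_
  exact isOpen_iInter_of_finite fun i => isOpen_iInter_of_finite fun _ =>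
    isOpen_iInter_of_finite fun _ => isOpen_lt (by fun_prop) continuous_const

end Tubes

end HolonomicApprox

namespace HolonomicApprox

/-! ### Families with parameters, and removal of one parameter. -/

variable {n q r k : ℕ}

local notation "E" => EuclideanSpace ℝ (Fin n)
local notation "G" => EuclideanSpace ℝ (Fin q)

/-- Approximation of the section `F` by the jets of a family of maps `g y`, holonomic over the
whole directions `i < j` of a sheared cube, and depending on the coordinates `j ≤ i < k` through
the parameter `y`. Near the boundary of the cube all these maps agree with `f₀`. -/
structure FiberedApprox (hk : k < n) (F : E → PreJet n q r) (f₀ : E → G) (B : Set E) (j : ℕ)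
    (d e : ℝ) (φ : EuclideanSpace ℝ (Fin k) → ℝ) (ρ : ℝ) (g : (Fin n → ℝ) → E → G) : Prop where
  pos : 0 < ρ
  smooth_shift : ContDiff ℝ ∞ φ
  abs_shift_le : ∀ v, |φ v| ≤ d
  shift_eq_zero : ∀ v, NearFace k ρ v → φ v = 0
  tube_subset : tube hk φ ρ ⊆ B
  contDiffOn : ∀ y, ContDiffOn ℝ ∞ (g y) (subtube hk φ ρ j y)
  norm_sub_le : ∀ y, ∀ x ∈ subtube hk φ ρ j y, ‖jet r (g y) x - F x‖ ≤ e
  equicontinuous : ∀ θ > 0, ∃ η > 0, ∀ y y' x, x ∈ subtube hk φ ρ j y → x ∈ subtube hk φ ρ j y' →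
    (∀ i : Fin n, j ≤ (i : ℕ) → (i : ℕ) < k → |y i - y' i| ≤ η) →
    ‖jet r (g y) x - jet r (g y') x‖ ≤ θ
  eq_of_nearFace : ∀ y, ∀ x ∈ subtube hk φ ρ j y, NearFace k ρ x → g y x = f₀ x

theorem FiberedApprox.contDiffAt {hk : k < n} {F : E → PreJet n q r} {f₀ : E → G} {B : Set E}
    {j : ℕ} {d e : ℝ} {φ : EuclideanSpace ℝ (Fin k) → ℝ} {ρ : ℝ} {g : (Fin n → ℝ) → E → G}
    (S : FiberedApprox hk F f₀ B j d e φ ρ g) {y : Fin n → ℝ} {x : E}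
    (hx : x ∈ subtube hk φ ρ j y) : ContDiffAt ℝ ∞ (g y) x :=
  (S.contDiffOn y).contDiffAt ((isOpen_subtube hk S.smooth_shift.continuous ρ j y).mem_nhds hx)

/-- Removal of one parameter: holonomic maps attached to neighbouring parameter values are
interpolated in the last direction, across a cube that oscillates between the two sides. -/
theorem FiberedApprox.step {hk : k < n} {F : E → PreJet n q r} {f₀ : E → G} {B : Set E}
    (hB : IsCompact B) {j : ℕ} (hj : j < k)
    {d e : ℝ} {φ : EuclideanSpace ℝ (Fin k) → ℝ} {ρ : ℝ} {g : (Fin n → ℝ) → E → G}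
    (S : FiberedApprox hk F f₀ B j d e φ ρ g) {d' e' : ℝ} (hd : d < d') (he : e < e') :
    ∃ φ' ρ' g', FiberedApprox hk F f₀ B (j + 1) d' e' φ' ρ' g' := by
  have hρ := S.pos
  have hfc := contDiff_firstCoords (n := n) hk.le
  let jk : Fin k := ⟨j, hj⟩
  let jn : Fin n := ⟨j, hj.trans hk⟩
  let l : Fin n := ⟨n - 1, by omega⟩
  -- `a` is the amplitude of the wave: `ρ / 4` keeps the new tube inside the old one, `d' - d`
  -- respects the bound on the shift.
  obtain ⟨a, ha, haρ, had⟩ : ∃ a : ℝ, 0 < a ∧ a ≤ ρ / 4 ∧ a ≤ d' - d :=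
    ⟨min (ρ / 4) (d' - d), lt_min (by linarith) (by linarith), min_le_left _ _, min_le_right _ _⟩
  -- the interpolating function
  let ψ : E → ℝ := fun x => Real.smoothTransition ((x l - φ (firstCoords hk.le x)) / a + 1 / 2)
  have hψ : ContDiff ℝ ∞ ψ := by
    refine Real.smoothTransition.contDiff.comp ?_
    have := S.smooth_shift.comp hfc
    have h2 : ContDiff ℝ ∞ fun x : E => x l := by fun_prop
    exact ((h2.sub this).div_const a).add contDiff_const
  have hψ0 : ∀ x : E, x l - φ (firstCoords hk.le x) ≤ -(a / 2) → ψ x = 0 := fun x hx =>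
    Real.smoothTransition.zero_of_nonpos (by
      have : (x l - φ (firstCoords hk.le x)) / a ≤ -(1 / 2) := by
        rw [div_le_iff₀ ha]; linarith
      linarith)
  have hψ1 : ∀ x : E, a / 2 ≤ x l - φ (firstCoords hk.le x) → ψ x = 1 := fun x hx =>
    Real.smoothTransition.one_of_one_le (by
      have : 1 / 2 ≤ (x l - φ (firstCoords hk.le x)) / a := by
        rw [le_div_iff₀ ha]; linarith
      linarith)
  -- The order of choices is decisive: `C` depends on `a` but precedes the frequency `M`.
  obtain ⟨C, hC, hCψ⟩ := exists_norm_jet_smul_le (q := q) r hψ hB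
  obtain ⟨θ, hθ, hθe⟩ : ∃ θ > 0, C * θ ≤ e' - e :=
    ⟨(e' - e) / (C + 1), by apply div_pos <;> linarith, by
      rw [mul_div_assoc', div_le_iff₀ (by linarith)]; nlinarith⟩
  obtain ⟨η, hη, hgη⟩ := S.equicontinuous θ hθ
  -- Both centres lie within `1 / M` of the point: `η / 2` puts them within `η` of each other, and
  -- `ρ` keeps the point in both old subtubes.
  obtain ⟨N, hN⟩ := exists_nat_one_div_lt (lt_min (half_pos hη) hρ)
  replace hN : (1 : ℝ) / ((N + 1 : ℕ) : ℝ) < min (η / 2) ρ := by exact_mod_cast hN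
  generalize hM : N + 1 = M at hN
  have hMpos : 0 < M := by omega
  obtain ⟨hNη, hNρ⟩ := lt_min_iff.1 hN
  obtain ⟨β, hβ, hβ1, hβface, hβint⟩ := exists_cubeCutoff k hρ
  let φ' : EuclideanSpace ℝ (Fin k) → ℝ := fun v =>
    φ v + a * (β v * Real.cos (M * v jk * Real.pi))
  have hφ' : ContDiff ℝ ∞ φ' := by
    have h2 : ContDiff ℝ ∞ fun v : EuclideanSpace ℝ (Fin k) => M * v jk * Real.pi := by fun_prop
    exact S.smooth_shift.add (contDiff_const.mul (hβ.mul (Real.contDiff_cos.comp h2)))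
  have hφφ' : ∀ v, |φ' v - φ v| ≤ a := fun v => by
    rw [show φ' v - φ v = a * (β v * Real.cos (M * v jk * Real.pi)) by simp [φ'], abs_mul, abs_mul,
      abs_of_pos ha]
    exact mul_le_of_le_one_right ha.le
      (mul_le_one₀ (hβ1 v) (abs_nonneg _) (Real.abs_cos_le_one _))
  have htube : tube hk φ' (a / 4) ⊆ tube hk φ ρ := by
    rintro x ⟨h1, h2, h3⟩
    refine ⟨fun i hi => ?_, fun i hi hi' => ?_, ?_⟩
    · obtain ⟨h4, h5⟩ := h1 i hi
      constructor <;> linarith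
    · have := h2 i hi hi'
      linarith
    · have h4 := hφφ' (firstCoords hk.le x)
      rw [abs_lt] at h3 ⊢
      rw [abs_le] at h4
      constructor <;> linarith
  have hupd : ∀ (y : Fin n → ℝ) (x : E) (c : ℝ), x ∈ subtube hk φ' (a / 4) (j + 1) y →
      |x jn - c| < ρ → x ∈ subtube hk φ ρ j (Function.update y jn c) := by
    rintro y x c ⟨hx, hxy⟩ hc
    refine ⟨htube hx, fun i hi hik => ?_⟩
    by_cases hij : i = jn
    · subst hij
      simpa using hc
    · have hij' : (i : ℕ) ≠ j := fun h => hij (Fin.ext h)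
      rw [Function.update_of_ne hij]
      have := hxy i (by omega) hik
      linarith
  let blend : (Fin n → ℝ) → ℝ → ℝ → E → G := fun y c₁ c₂ x =>
    ψ x • g (Function.update y jn c₁) x + (1 - ψ x) • g (Function.update y jn c₂) x
  let g' : (Fin n → ℝ) → E → G := fun y x => blend y (nearEven M (x jn)) (nearOdd M (x jn)) x
  have hopen : ∀ y, IsOpen (subtube hk φ' (a / 4) (j + 1) y) := fun y =>
    isOpen_subtube hk hφ'.continuous _ _ y
  have heven : ∀ t, |t - nearEven M t| < ρ := fun t => (abs_sub_nearEven_le hMpos t).trans_lt hNρ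
  have hodd : ∀ t, |t - nearOdd M t| < ρ := fun t => (abs_sub_nearOdd_le hMpos t).trans_lt hNρ
  have hface : ∀ y x c₁ c₂, x ∈ subtube hk φ' (a / 4) (j + 1) y → |x jn - c₁| < ρ →
      |x jn - c₂| < ρ → NearFace k ρ x → blend y c₁ c₂ x = f₀ x := by
    intro y x c₁ c₂ hx h1 h2 hf
    simp only [blend]
    rw [S.eq_of_nearFace _ x (hupd y x c₁ hx h1) hf, S.eq_of_nearFace _ x (hupd y x c₂ hx h2) hf,
      ← add_smul, add_sub_cancel, one_smul]
  -- Although rounding is discontinuous, the germ of `g' y` at each point is that of a blend with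
  -- frozen centres; smoothness and jets are read off from it.
  have hlocal : ∀ y x₀, x₀ ∈ subtube hk φ' (a / 4) (j + 1) y →
      g' y =ᶠ[𝓝 x₀] blend y (nearEven M (x₀ jn)) (nearOdd M (x₀ jn)) := by
    intro y x₀ hx₀
    have hcj : Continuous fun x : E => x jn := by fun_prop
    -- Near a face every map is `f₀`, so the centres are irrelevant; elsewhere `β = 1` and the wave
    -- has full amplitude.
    by_cases hf : NearFace k (ρ / 2) x₀
    · have h1 : ∀ᶠ x : E in 𝓝 x₀, |x jn - nearEven M (x₀ jn)| < ρ :=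
        (by fun_prop : Continuous fun x : E => |x jn - nearEven M (x₀ jn)|).continuousAt.eventually
          (gt_mem_nhds (heven _))
      have h2 : ∀ᶠ x : E in 𝓝 x₀, |x jn - nearOdd M (x₀ jn)| < ρ :=
        (by fun_prop : Continuous fun x : E => |x jn - nearOdd M (x₀ jn)|).continuousAt.eventually
          (gt_mem_nhds (hodd _))
      filter_upwards [h1, h2, (hopen y).mem_nhds hx₀, (isOpen_nearFace k (ρ / 2)).mem_nhds hf]
        with x hx1 hx2 hx hxf
      have hxf' : NearFace k ρ x := NearFace.mono (by linarith) hxf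
      rw [hface y x _ _ hx hx1 hx2 hxf']
      exact hface y x _ _ hx (heven _) (hodd _) hxf'
    · have hβ0 : β (firstCoords hk.le x₀) = 1 :=
        hβint _ fun h => hf ((nearFace_firstCoords hk.le).1 h)
      have hcos : |x₀ l - φ (firstCoords hk.le x₀) - a * Real.cos (M * x₀ jn * Real.pi)| < a / 4 := by
        have h := hx₀.1.2.2
        simp only [φ', hβ0, one_mul] at h
        rw [sub_sub]
        exact h
      rw [abs_lt] at hcos
      have hcs : Continuous fun x : E => x l - φ (firstCoords hk.le x) :=
        (by fun_prop : Continuous fun x : E => x l).sub (S.smooth_shift.comp hfc).continuous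
      have h1 : ∀ᶠ x : E in 𝓝 x₀, ψ x • g (Function.update y jn (nearEven M (x jn))) x =
          ψ x • g (Function.update y jn (nearEven M (x₀ jn))) x := by
        -- In a trough the height over `φ` is below `-a + a / 4 < -(a / 2)`, so the even map, which
        -- may jump here, has weight zero nearby. Crests treat the odd map in the same way.
        by_cases hc : Real.cos (M * x₀ jn * Real.pi) = -1
        · have h0 : x₀ l - φ (firstCoords hk.le x₀) < -(a / 2) := by
            rw [hc] at hcos; linarith
          filter_upwards [hcs.continuousAt.eventually (gt_mem_nhds h0)] with x hx
          rw [hψ0 x hx.le, zero_smul, zero_smul]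
        · filter_upwards [hcj.continuousAt.eventually (eventually_nearEven_eq hc)] with x hx
          rw [hx]
      have h2 : ∀ᶠ x : E in 𝓝 x₀, (1 - ψ x) • g (Function.update y jn (nearOdd M (x jn))) x =
          (1 - ψ x) • g (Function.update y jn (nearOdd M (x₀ jn))) x := by
        by_cases hc : Real.cos (M * x₀ jn * Real.pi) = 1
        · have h0 : a / 2 < x₀ l - φ (firstCoords hk.le x₀) := by
            rw [hc] at hcos; linarith
          filter_upwards [hcs.continuousAt.eventually (lt_mem_nhds h0)] with x hx
          rw [hψ1 x hx.le, sub_self, zero_smul, zero_smul]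
        · filter_upwards [hcj.continuousAt.eventually (eventually_nearOdd_eq hc)] with x hx
          rw [hx]
      filter_upwards [h1, h2] with x hx1 hx2
      simp only [g', blend]
      rw [hx1, hx2]
  have hsm : ∀ y x, x ∈ subtube hk φ' (a / 4) (j + 1) y →
      ContDiffAt ℝ ∞ (g (Function.update y jn (nearEven M (x jn)))) x ∧
      ContDiffAt ℝ ∞ (g (Function.update y jn (nearOdd M (x jn)))) x := fun y x hx =>
    ⟨S.contDiffAt (hupd y x _ hx (heven _)), S.contDiffAt (hupd y x _ hx (hodd _))⟩
  -- Rewritten as odd map plus `ψ` times (even minus odd), so that `C` multiplies only a small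
  -- difference.
  have hjet : ∀ y x, x ∈ subtube hk φ' (a / 4) (j + 1) y → jet r (g' y) x =
      jet r (fun z => ψ z • (g (Function.update y jn (nearEven M (x jn))) z -
        g (Function.update y jn (nearOdd M (x jn))) z)) x +
      jet r (g (Function.update y jn (nearOdd M (x jn)))) x := by
    intro y x hx
    obtain ⟨h1, h2⟩ := hsm y x hx
    have h3 : ContDiffAt ℝ ∞ (fun z => ψ z • (g (Function.update y jn (nearEven M (x jn))) z -
        g (Function.update y jn (nearOdd M (x jn))) z)) x := hψ.contDiffAt.smul (h1.sub h2)
    rw [jet_congr (hlocal y x hx), ← jet_add h3 h2]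
    congr 1
    funext z
    simp only [blend]
    module
  refine ⟨φ', a / 4, g', ?_⟩
  refine ⟨by linarith, hφ', fun v => ?_, fun v hv => ?_, htube.trans S.tube_subset, fun y x hx => ?_,
    fun y x hx => ?_, fun θ' hθ' => ?_, fun y x hx hf => ?_⟩
  · have h1 := hφφ' v
    have h2 := S.abs_shift_le v
    rw [abs_le] at h1 h2 ⊢
    constructor <;> linarith
  · simp only [φ']
    rw [hβface v (hv.mono (by linarith)), S.shift_eq_zero v (hv.mono (by linarith))]
    simp
  · obtain ⟨h1, h2⟩ := hsm y x hx
    refine (ContDiffAt.congr_of_eventuallyEq ?_ (hlocal y x hx)).contDiffWithinAt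
    exact (hψ.contDiffAt.smul h1).add ((contDiffAt_const.sub hψ.contDiffAt).smul h2)
  · obtain ⟨h1, h2⟩ := hsm y x hx
    have hxe := hupd y x _ hx (heven _)
    have hxo := hupd y x _ hx (hodd _)
    have h3 := hCψ x (S.tube_subset hxe.1) _ (h1.sub h2)
    rw [jet_sub h1 h2] at h3
    have h4 := hgη _ _ x hxe hxo fun i _ _ => by
      by_cases hij : i = jn
      · subst hij
        have h5 := abs_sub_nearEven_le hMpos (x jn)
        have h6 := abs_sub_nearOdd_le hMpos (x jn)
        simp only [Function.update_self]
        rw [abs_le] at h5 h6 ⊢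
        constructor <;> linarith
      · simp [Function.update_of_ne hij, hη.le]
    have h5 := S.norm_sub_le _ x hxo
    rw [hjet y x hx, add_sub_assoc]
    refine (norm_add_le _ _).trans ?_
    have h6 := mul_le_mul_of_nonneg_left h4 hC
    linarith
  -- Two differences, even and odd, are multiplied by `ψ`, and one odd difference is not: `2 * C +
  -- 1`. The centres depend on `x` alone, hence agree for `y` and `y'`.
  · obtain ⟨η', hη', hη'g⟩ := S.equicontinuous (θ' / (2 * C + 1)) (by positivity)
    refine ⟨η', hη', fun y y' x hx hx' hyy' => ?_⟩
    obtain ⟨h1, h2⟩ := hsm y x hx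
    obtain ⟨h1', h2'⟩ := hsm y' x hx'
    have hclose : ∀ c, ∀ i : Fin n, j ≤ (i : ℕ) → (i : ℕ) < k →
        |Function.update y jn c i - Function.update y' jn c i| ≤ η' := fun c i hi hik => by
      by_cases hij : i = jn
      · subst hij
        simp [hη'.le]
      · have hij' : (i : ℕ) ≠ j := fun h => hij (Fin.ext h)
        simp only [Function.update_of_ne hij]
        exact hyy' i (by omega) hik
    have h3 := hη'g _ _ x (hupd y x _ hx (heven _)) (hupd y' x _ hx' (heven _)) (hclose _)
    have h4 := hη'g _ _ x (hupd y x _ hx (hodd _)) (hupd y' x _ hx' (hodd _)) (hclose _)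
    have hxB : x ∈ B := S.tube_subset (htube hx.1)
    have hs := h1.sub h2
    have hs' := h1'.sub h2'
    have h5 := hCψ x hxB _ (hs.sub hs')
    have h6 := jet_sub (r := r) (hψ.contDiffAt.smul hs) (hψ.contDiffAt.smul hs')
    have h7 : ∀ f f' : E → G, (fun z => (ψ • f) z - (ψ • f') z) = fun z => ψ z • (f - f') z :=
      fun f f' => funext fun z => (smul_sub (ψ z) (f z) (f' z)).symm
    rw [h7] at h6
    have h8 : jet r (fun z => (g (Function.update y jn (nearEven M (x jn))) -
          g (Function.update y jn (nearOdd M (x jn)))) z -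
        (g (Function.update y' jn (nearEven M (x jn))) -
          g (Function.update y' jn (nearOdd M (x jn)))) z) x = _ :=
      (jet_sub hs hs').trans (congrArg₂ (· - ·) (jet_sub h1 h2) (jet_sub h1' h2'))
    rw [hjet y x hx, hjet y' x hx', add_sub_add_comm]
    refine (norm_add_le _ _).trans ?_
    have h9 := (congrArg norm h6).symm.le.trans (h5.trans (mul_le_mul_of_nonneg_left
      ((congrArg norm h8).le.trans ((congrArg norm (sub_sub_sub_comm _ _ _ _)).le.trans
        ((_root_.norm_sub_le _ _).trans (add_le_add h3 h4)))) hC))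
    refine (add_le_add h9 h4).trans (le_of_eq ?_)
    field_simp
    ring
  · exact hface y x _ _ hx (heven _) (hodd _) (hf.mono (by linarith))

end HolonomicApprox

/-! ### Geometry of the cube and its boundary. -/

namespace HolonomicApprox

variable {n q r k : ℕ}

local notation "E" => EuclideanSpace ℝ (Fin n)
local notation "G" => EuclideanSpace ℝ (Fin q)

theorem exists_coord_dist_lt (n : ℕ) {μ : ℝ} (hμ : 0 < μ) :
    ∃ ρ > 0, ∀ x y : EuclideanSpace ℝ (Fin n), (∀ i, |x i - y i| ≤ ρ) → dist x y < μ := by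
  have h : UniformContinuous (WithLp.toLp 2 : (Fin n → ℝ) → EuclideanSpace ℝ (Fin n)) :=
    PiLp.uniformContinuous_toLp 2 _
  obtain ⟨ρ, hρ, H⟩ := Metric.uniformContinuous_iff.1 h μ hμ
  refine ⟨ρ / 2, half_pos hρ, fun x y hxy => ?_⟩
  refine H (a := x.ofLp) (b := y.ofLp) (lt_of_le_of_lt ?_ (half_lt_self hρ))
  rw [dist_pi_le_iff (half_pos hρ).le]
  exact fun i => (Real.dist_eq _ _).le.trans (hxy i)

theorem isClosed_cube (n k : ℕ) : IsClosed (cube n k) := by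
  simp only [cube, Set.ofPred_forall, Set.ofPred_and]
  refine isClosed_iInter fun i => IsClosed.inter ?_ ?_
  · exact isClosed_iInter fun _ => isClosed_Icc.preimage (by fun_prop)
  · exact isClosed_iInter fun _ => isClosed_eq (by fun_prop) continuous_const

theorem isCompact_cube (n k : ℕ) : IsCompact (cube n k) := by
  have h : IsCompact ((WithLp.toLp 2 : (Fin n → ℝ) → EuclideanSpace ℝ (Fin n)) ''
      Set.univ.pi fun _ => Set.Icc (0 : ℝ) 1) :=
    (isCompact_univ_pi fun _ => isCompact_Icc).image (PiLp.continuous_toLp 2 _)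
  refine h.of_isClosed_subset (isClosed_cube n k) fun x hx => ⟨x.ofLp, fun i _ => ?_, rfl⟩
  by_cases hi : (i : ℕ) < k
  · exact (hx i).1 hi
  · rw [(hx i).2 (not_lt.1 hi)]
    simp

theorem isCompact_cubeBoundary (n k : ℕ) : IsCompact (cubeBoundary n k) := by
  refine (isCompact_cube n k).of_isClosed_subset ?_ fun x hx => hx.1
  simp only [cubeBoundary, Set.ofPred_and, Set.ofPred_exists, Set.ofPred_or]
  refine (isClosed_cube n k).inter (isClosed_iUnion_of_finite fun i => isClosed_const.inter ?_)
  exact (isClosed_eq (by fun_prop) continuous_const).union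
    (isClosed_eq (by fun_prop) continuous_const)

theorem exists_cubeBoundary_close {ρ : ℝ} {z : E} (hz : z ∈ cube n k) (h : NearFace k ρ z) :
    ∃ b ∈ cubeBoundary n k, ∀ i, |z i - b i| ≤ ρ := by
  obtain ⟨i, hi, h⟩ := h
  have hzi := (hz i).1 hi
  obtain ⟨c, hc, hzc⟩ : ∃ c : ℝ, (c = 0 ∨ c = 1) ∧ |z i - c| ≤ ρ := by
    rcases h with h | h
    · exact ⟨0, Or.inl rfl, by rw [sub_zero, abs_of_nonneg hzi.1]; exact h.le⟩
    · exact ⟨1, Or.inr rfl, by rw [abs_sub_comm, abs_of_nonneg] <;> linarith [hzi.2]⟩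
  refine ⟨WithLp.toLp 2 (Function.update z.ofLp i c), ⟨fun m => ?_, i, hi, by simpa using hc⟩,
    fun m => ?_⟩
  · by_cases hm : m = i
    · subst hm
      refine ⟨fun _ => ?_, fun h' => absurd hi (not_lt.2 h')⟩
      rcases hc with rfl | rfl <;> simp
    · simpa [Function.update_of_ne hm] using hz m
  · by_cases hm : m = i
    · subst hm
      simpa using hzc
    · simpa [Function.update_of_ne hm] using (abs_nonneg _).trans hzc

/-- The nearest point of the unit cube. -/
noncomputable def clampCube (n k : ℕ) (y : Fin n → ℝ) :
    EuclideanSpace ℝ (Fin n) :=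
  WithLp.toLp 2 fun i => if (i : ℕ) < k then max 0 (min 1 (y i)) else 0

theorem clampCube_mem (y : Fin n → ℝ) : clampCube n k y ∈ cube n k := by
  intro i
  refine ⟨fun hi => ?_, fun hi => ?_⟩
  · simp [clampCube, hi]
  · simp [clampCube, not_lt.2 hi]

theorem abs_clampCube_sub_le (y y' : Fin n → ℝ) {η : ℝ} (hη : 0 ≤ η)
    (h : ∀ i : Fin n, (i : ℕ) < k → |y i - y' i| ≤ η) (i : Fin n) :
    |clampCube n k y i - clampCube n k y' i| ≤ η := by
  by_cases hi : (i : ℕ) < k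
  · simp only [clampCube, hi, if_true]
    rw [max_comm, max_comm 0, min_comm, min_comm 1]
    exact (abs_max_sub_max_le_abs _ _ _).trans ((abs_min_sub_min_le_max _ _ _ _).trans
      (by simpa using h i hi))
  · simpa [clampCube, hi] using hη

theorem abs_sub_clampCube_le (hk : k < n) {ρ : ℝ} {y : Fin n → ℝ} {x : E}
    (hx : x ∈ subtube hk (fun _ => 0) ρ 0 y) (i : Fin n) : |x i - clampCube n k y i| ≤ 2 * ρ := by
  obtain ⟨⟨h1, h2, h3⟩, h4⟩ := hx
  have hρ : 0 < ρ := (abs_nonneg _).trans_lt h3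
  by_cases hi : (i : ℕ) < k
  · have h5 := abs_lt.1 (h4 i (Nat.zero_le _) hi)
    obtain ⟨h6, h7⟩ := h1 i hi
    simp only [clampCube, hi, if_true]
    rw [abs_le]
    rcases max_cases 0 (min 1 (y i)) with ⟨h8, h9⟩ | ⟨h8, h9⟩ <;>
      rcases min_cases 1 (y i) with ⟨h10, h11⟩ | ⟨h10, h11⟩ <;> rw [h8] <;>
      try rw [h10]
    all_goals constructor <;> linarith
  · simp only [clampCube, hi, if_false, sub_zero]
    by_cases hin : (i : ℕ) + 1 = n
    · have : i = ⟨n - 1, by omega⟩ := Fin.ext (by simp; omega)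
      rw [← this, sub_zero] at h3
      linarith
    · linarith [h2 i (not_lt.1 hi) hin]

/-! ### The initial family: Taylor polynomials blended with `f₀`. -/

/-- A section which is holonomic near a compact set agrees near it with the jet of a map that is
smooth on the whole space. -/
theorem exists_contDiff_jet_eq {F : E → JetFiber n q r} {K V : Set E} (hK : IsCompact K)
    (hKV : K ⊆ V) (hF : IsHolonomicOn F V) :
    ∃ f₀ : E → G, ContDiff ℝ ∞ f₀ ∧ ∃ V₀, IsOpen V₀ ∧ K ⊆ V₀ ∧
      ∀ x ∈ V₀, jet r f₀ x = (F x : PreJet n q r) := by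
  obtain ⟨hV, f, hf, hFf⟩ := hF
  obtain ⟨κ, hκ, hκV⟩ := hK.exists_cthickening_subset_open hV hKV
  obtain ⟨χ, h1, h0, -⟩ := exists_contMDiffMap_one_nhds_of_subset_interior 𝓘(ℝ, E) (n := ⊤)
    hK.isClosed (t := Metric.cthickening κ K)
    ((Metric.self_subset_thickening hκ K).trans
      (interior_maximal (Metric.thickening_subset_cthickening κ K) Metric.isOpen_thickening))
  have hχ : ContDiff ℝ ∞ χ := χ.contMDiff.contDiff
  obtain ⟨V₁, hV₁, hKV₁, hχV₁⟩ := mem_nhdsSet_iff_exists.1 h1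
  refine ⟨fun x => χ x • f x, contDiff_iff_contDiffAt.2 fun x => ?_, V₁ ∩ V, hV₁.inter hV,
    Set.subset_inter hKV₁ hKV, fun x hx => ?_⟩
  · by_cases hx : x ∈ V
    · exact hχ.contDiffAt.smul (hf.contDiffAt (hV.mem_nhds hx))
    · have hx' : (Metric.cthickening κ K)ᶜ ∈ 𝓝 x :=
        Metric.isClosed_cthickening.isOpen_compl.mem_nhds fun h => hx (hκV h)
      refine (contDiffAt_const (c := (0 : G))).congr_of_eventuallyEq ?_
      filter_upwards [hx'] with y hy
      rw [h0 y hy, zero_smul]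
  · rw [hFf x hx.2]
    refine jet_congr ?_
    filter_upwards [hV₁.mem_nhds hx.1] with y hy
    have : χ y = 1 := hχV₁ hy
    rw [this, one_smul]

/-- Interpolation of `f₀` and of the Taylor polynomials of a section. -/
noncomputable def taylorBlend (f₀ : E → G) (w : ℝ × PreJet n q r × E) (x : E) : G :=
  w.1 • f₀ x + (1 - w.1) • taylorPoly w.2.1 w.2.2 x

theorem contDiff_taylorBlend {f₀ : E → G} (hf₀ : ContDiff ℝ ∞ f₀) :
    ContDiff ℝ ∞ (Function.uncurry (taylorBlend (r := r) f₀)) := by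
  have h1 : ContDiff ℝ ∞ fun w : (ℝ × PreJet n q r × E) × E => w.1.1 := by fun_prop
  have h2 : ContDiff ℝ ∞ fun w : (ℝ × PreJet n q r × E) × E => f₀ w.2 := hf₀.comp contDiff_snd
  have h3 : ContDiff ℝ ∞ fun w : (ℝ × PreJet n q r × E) × E => taylorPoly w.1.2.1 w.1.2.2 w.2 :=
    contDiff_taylorPoly.comp (f := fun w : (ℝ × PreJet n q r × E) × E =>
      ((w.1.2.1, w.1.2.2), w.2)) (by fun_prop)
  exact (h1.smul h2).add ((contDiff_const.sub h1).smul h3)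

theorem continuous_jet_taylorBlend {f₀ : E → G} (hf₀ : ContDiff ℝ ∞ f₀) :
    Continuous fun s : (ℝ × PreJet n q r × E) × E => jet r (taylorBlend f₀ s.1) s.2 :=
  continuous_jet_param (contDiff_taylorBlend hf₀)

theorem continuousOn_jet_taylorBlend {f₀ : E → G} (hf₀ : ContDiff ℝ ∞ f₀) {X : Type*}
    [TopologicalSpace X] {s : Set X} {c : X → ℝ} {p : X → PreJet n q r} {z x : X → E}
    (hc : ContinuousOn c s) (hp : ContinuousOn p s) (hz : ContinuousOn z s)
    (hx : ContinuousOn x s) :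
    ContinuousOn (fun a => jet r (taylorBlend f₀ (c a, p a, z a)) (x a)) s := by
  have h1 := (hc.prodMk (hp.prodMk hz)).prodMk hx
  have h2 := ContinuousOn.comp
    (g := fun s : (ℝ × PreJet n q r × E) × E => jet r (taylorBlend f₀ s.1) s.2)
    (continuous_jet_taylorBlend hf₀).continuousOn h1 (Set.mapsTo_univ _ _)
  exact h2

/-- The weight is constant in `x`, so no derivative falls on it: the jet is an affine combination of
jets equal to `p`, except where `f₀` has weight zero. -/
theorem jet_taylorBlend {f₀ : E → G} (hf₀ : ContDiff ℝ ∞ f₀) {c : ℝ} {p : PreJet n q r} {z : E}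
    (hp : p ∈ JetFiber n q r) (hc : c = 0 ∨ jet r f₀ z = p) :
    jet r (taylorBlend f₀ (c, p, z)) z = p := by
  have h : ContDiff ℝ ∞ (taylorPoly p z) := contDiff_taylorPoly.comp
    (f := fun x : E => ((p, z), x)) (by fun_prop)
  have h1 := jet_add (r := r) (hf₀.contDiffAt.const_smul c)
    (h.contDiffAt.const_smul (1 - c) : ContDiffAt ℝ ∞ _ z)
  refine h1.trans ?_
  rw [jet_const_smul hf₀.contDiffAt, jet_const_smul h.contDiffAt, jet_taylorPoly hp]
  have h2 : c • jet r f₀ z = c • p := by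
    rcases hc with rfl | hc
    · exact (zero_smul ℝ (jet r f₀ z)).trans (zero_smul ℝ p).symm
    · rw [hc]
  rw [h2]
  refine (add_smul c (1 - c) p).symm.trans ?_
  rw [add_sub_cancel]
  exact one_smul ℝ p

/-- The pointwise approximation of a section by Taylor polynomials, with parameters in the whole
cube. -/
theorem exists_fiberedApprox_zero (hk : k < n) {U : Set E} (hU : IsOpen U)
    (hIU : cube n k ⊆ U) {F : E → JetFiber n q r} (hF : ContinuousOn F U) {f₀ : E → G}
    (hf₀ : ContDiff ℝ ∞ f₀) {V₀ : Set E} (hV₀ : IsOpen V₀) (hbV : cubeBoundary n k ⊆ V₀)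
    (hFf₀ : ∀ x ∈ V₀, jet r f₀ x = (F x : PreJet n q r)) {e : ℝ} (he : 0 < e) :
    ∃ B, IsCompact B ∧ B ⊆ U ∧ ∃ ρ g,
      FiberedApprox hk (fun x => (F x : PreJet n q r)) f₀ B 0 0 e (fun _ => 0) ρ g := by
  obtain ⟨μ, hμ, hμU⟩ := (isCompact_cube n k).exists_cthickening_subset_open hU hIU
  obtain ⟨ν, hν, hνV⟩ := (isCompact_cubeBoundary n k).exists_cthickening_subset_open hV₀ hbV
  let B := Metric.cthickening μ (cube n k)
  have hB : IsCompact B := (isCompact_cube n k).cthickening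
  have hcB : cube n k ⊆ B := Metric.self_subset_cthickening _
  obtain ⟨ψ, hψ0, hψ1, -⟩ := exists_continuous_zero_one_of_isClosed hV₀.isClosed_compl
    (Metric.isClosed_cthickening : IsClosed (Metric.cthickening ν (cubeBoundary n k)))
    (Set.disjoint_left.2 fun x hx hx' => hx (hνV hx'))
  let w : E → ℝ × PreJet n q r × E := fun z => (ψ z, (F z : PreJet n q r), z)
  have hF' : ContinuousOn (fun x => (F x : PreJet n q r)) U :=
    continuous_subtype_val.comp_continuousOn hF
  -- Error at the point `s.2` of the map centred at `s.1`. It vanishes on the diagonal, so uniform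
  -- continuity on a compact set gives both the error bound and equicontinuity.
  let Ψ : E × E → PreJet n q r := fun s => jet r (taylorBlend f₀ (w s.1)) s.2 - F s.2
  have hΨ : ContinuousOn Ψ (cube n k ×ˢ B) := by
    have h1 : ContinuousOn (fun s : E × E => (F s.1 : PreJet n q r)) (cube n k ×ˢ B) :=
      (hF'.mono hIU).comp continuousOn_fst fun s hs => hs.1
    have h2 := continuousOn_jet_taylorBlend hf₀ (ψ.continuous.comp continuous_fst).continuousOn h1
      continuousOn_fst continuousOn_snd
    have h3 : ContinuousOn (fun s : E × E => (F s.2 : PreJet n q r)) (cube n k ×ˢ B) :=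
      (hF'.mono hμU).comp continuousOn_snd fun s hs => hs.2
    exact h2.sub h3
  have hΨ0 : ∀ z, Ψ (z, z) = 0 := fun z => by
    refine sub_eq_zero.2 (jet_taylorBlend hf₀ (F z).2 ?_)
    by_cases hz : z ∈ V₀
    · exact Or.inr (hFf₀ z hz)
    · exact Or.inl (hψ0 hz)
  have hunif := Metric.uniformContinuousOn_iff.1
    (((isCompact_cube n k).prod hB).uniformContinuousOn_of_continuous hΨ)
  obtain ⟨τ, hτ, hΨτ⟩ := hunif e he
  obtain ⟨ρ₀, hρ₀, hclose⟩ := exists_coord_dist_lt n (lt_min hμ (lt_min hν hτ))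
  -- A point is within two thirds of `ρ₀` of its centre in each coordinate; being within one third
  -- of a face, it forces the centre within `ρ₀` of that face.
  have hρ : 0 < ρ₀ / 3 := by linarith
  let g : (Fin n → ℝ) → E → G := fun y => taylorBlend f₀ (w (clampCube n k y))
  have hdist : ∀ y x, x ∈ subtube hk (fun _ => 0) (ρ₀ / 3) 0 y →
      dist x (clampCube n k y) < min μ (min ν τ) := fun y x hx =>
    hclose _ _ fun i => (abs_sub_clampCube_le hk hx i).trans (by linarith)
  have htB : tube hk (fun _ => 0) (ρ₀ / 3) ⊆ B := fun x hx =>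
    Metric.mem_cthickening_of_dist_le x (clampCube n k x.ofLp) μ _ (clampCube_mem _)
      ((hdist x.ofLp x ⟨hx, fun i _ _ => by simpa using hρ⟩).le.trans (min_le_left _ _))
  refine ⟨B, hB, hμU, ρ₀ / 3, g, hρ, contDiff_const, by simp, fun _ _ => rfl, htB,
    fun y => ?_, fun y x hx => ?_, fun θ hθ => ?_, fun y x hx hf => ?_⟩
  · exact ((contDiff_taylorBlend hf₀).comp (contDiff_const.prodMk contDiff_id)).contDiffOn
  · have hz := clampCube_mem (k := k) y
    have h := hΨτ (clampCube n k y, x) ⟨hz, htB hx.1⟩ (clampCube n k y, clampCube n k y)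
      ⟨hz, hcB hz⟩ (by
        rw [Prod.dist_eq, dist_self, max_eq_right dist_nonneg]
        exact (hdist y x hx).trans_le ((min_le_right _ _).trans (min_le_right _ _)))
    rw [hΨ0, dist_zero_right] at h
    exact h.le
  · obtain ⟨τ', hτ', hΨτ'⟩ := hunif θ hθ
    obtain ⟨η, hη, hclose'⟩ := exists_coord_dist_lt n hτ'
    refine ⟨η, hη, fun y y' x hx hx' h => ?_⟩
    have h1 := hΨτ' (clampCube n k y, x) ⟨clampCube_mem y, htB hx.1⟩ (clampCube n k y', x)
      ⟨clampCube_mem y', htB hx.1⟩ (by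
        rw [Prod.dist_eq, dist_self, max_eq_left dist_nonneg]
        exact hclose' _ _ (abs_clampCube_sub_le y y' hη.le fun i hi => h i (Nat.zero_le _) hi))
    rw [dist_eq_norm] at h1
    simp only [Ψ, sub_sub_sub_cancel_right] at h1
    exact h1.le
  · have hz := clampCube_mem (k := k) y
    have hzf : NearFace k ρ₀ (clampCube n k y) := by
      obtain ⟨i, hi, h⟩ := hf
      have h1 := abs_le.1 (abs_sub_clampCube_le hk hx i)
      exact ⟨i, hi, h.imp (fun h => by linarith) (fun h => by linarith)⟩
    obtain ⟨b, hb, hzb⟩ := exists_cubeBoundary_close hz hzf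
    have h1 : ψ (clampCube n k y) = 1 := hψ1 (Metric.mem_cthickening_of_dist_le _ b ν _ hb
      ((hclose _ _ hzb).le.trans ((min_le_right _ _).trans (min_le_left _ _))))
    simp only [g, taylorBlend, w]
    rw [h1]
    simp

/-- Each step may cost arbitrarily little, so half of each remaining margin is reserved for the last
step and the other half for the earlier ones. -/
theorem exists_fiberedApprox {hk : k < n} {F : E → PreJet n q r} {f₀ : E → G} {B : Set E}
    (hB : IsCompact B) {e : ℝ} {ρ : ℝ} {g : (Fin n → ℝ) → E → G}
    (S : FiberedApprox hk F f₀ B 0 0 e (fun _ => 0) ρ g) {j : ℕ} (hj : j ≤ k) :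
    ∀ {d' e' : ℝ}, 0 < d' → e < e' → ∃ φ' ρ' g', FiberedApprox hk F f₀ B j d' e' φ' ρ' g' := by
  induction j with
  | zero =>
    intro d' e' hd he
    exact ⟨_, ρ, g, S.pos, S.smooth_shift, by simpa using hd.le, S.shift_eq_zero, S.tube_subset,
      S.contDiffOn, fun y x hx => (S.norm_sub_le y x hx).trans he.le, S.equicontinuous,
      S.eq_of_nearFace⟩
  | succ j ih =>
    intro d' e' hd he
    obtain ⟨φ, ρ, g, S'⟩ := ih (by omega) (half_pos hd) (left_lt_add_div_two.2 he)
    exact S'.step hB hj (half_lt_self hd) (add_div_two_lt_right.2 he)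

/-! ### The shear, and the conclusion. -/

theorem firstCoords_shear (hk : k < n) (φ : EuclideanSpace ℝ (Fin k) → ℝ) (x : E) :
    firstCoords hk.le (shear hk.le φ x) = firstCoords hk.le x := by
  ext i
  have : (i : ℕ) + 1 ≠ n := by omega
  simp [firstCoords, shear, this]

theorem contDiff_shear (hk : k < n) {φ : EuclideanSpace ℝ (Fin k) → ℝ} (hφ : ContDiff ℝ ∞ φ) :
    ContDiff ℝ ∞ (shear hk.le φ) := by
  rw [contDiff_euclidean]
  intro i
  simp only [shear]
  have h : ContDiff ℝ ∞ fun x : E => x i := by fun_prop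
  split_ifs
  · exact h.add (hφ.comp (contDiff_firstCoords hk.le))
  · exact h

theorem shear_neg_shear (hk : k < n) (φ : EuclideanSpace ℝ (Fin k) → ℝ) (x : E) :
    shear hk.le (fun v => -φ v) (shear hk.le φ x) = x := by
  ext i
  rw [shear, firstCoords_shear hk]
  by_cases hi : (i : ℕ) + 1 = n <;> simp [shear, hi]

/-- The shear along the last coordinate as a diffeomorphism. -/
noncomputable def shearDiffeomorph (hk : k < n) {φ : EuclideanSpace ℝ (Fin k) → ℝ}
    (hφ : ContDiff ℝ ∞ φ) : Diffeomorph 𝓘(ℝ, E) 𝓘(ℝ, E) E E ∞ where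
  toFun := shear hk.le φ
  invFun := shear hk.le fun v => -φ v
  left_inv := shear_neg_shear hk φ
  right_inv x := by simpa using shear_neg_shear hk (fun v => -φ v) x
  contMDiff_toFun := (contDiff_shear hk hφ).contMDiff
  contMDiff_invFun := (contDiff_shear hk hφ.neg).contMDiff

theorem shear_mem_tube (hk : k < n) {φ : EuclideanSpace ℝ (Fin k) → ℝ} {ρ : ℝ} (hρ : 0 < ρ) {x : E}
    (hx : x ∈ cube n k) : shear hk.le φ x ∈ tube hk φ ρ := by
  refine ⟨fun i hi => ?_, fun i hi hin => ?_, ?_⟩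
  · have h : (i : ℕ) + 1 ≠ n := by omega
    obtain ⟨h1, h2⟩ := (hx i).1 hi
    simp only [shear, h, if_false]
    constructor <;> linarith
  · simpa [shear, hin, (hx i).2 hi] using hρ
  · rw [firstCoords_shear hk]
    have h : n - 1 + 1 = n := by omega
    have h0 := (hx ⟨n - 1, by omega⟩).2 (by simp; omega)
    simpa [shear, h, h0] using hρ

theorem nearFace_of_mem_cubeBoundary {ρ : ℝ} (hρ : 0 < ρ) {x : E} (hx : x ∈ cubeBoundary n k) :
    NearFace k ρ x := by
  obtain ⟨-, i, hi, h⟩ := hx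
  exact ⟨i, hi, h.imp (fun h => by linarith) (fun h => by linarith)⟩

end HolonomicApprox

theorem theorem1p3p1 (n q r k : ℕ) (hk : k < n)
    (U : Set (EuclideanSpace ℝ (Fin n))) (hU : IsOpen U)
    (hIU : HolonomicApprox.cube n k ⊆ U)
    (F : EuclideanSpace ℝ (Fin n) → HolonomicApprox.JetFiber n q r)
    (hF : ContinuousOn F U)
    (hFhol : ∃ V : Set (EuclideanSpace ℝ (Fin n)),
      HolonomicApprox.cubeBoundary n k ⊆ V ∧ V ⊆ U ∧ HolonomicApprox.IsHolonomicOn F V)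
    (δ ε : ℝ) (hδ : 0 < δ) (hε : 0 < ε) :
    ∃ (φ : EuclideanSpace ℝ (Fin k) → ℝ)
      (h : Diffeomorph 𝓘(ℝ, EuclideanSpace ℝ (Fin n)) 𝓘(ℝ, EuclideanSpace ℝ (Fin n))
        (EuclideanSpace ℝ (Fin n)) (EuclideanSpace ℝ (Fin n)) ∞)
      (W : Set (EuclideanSpace ℝ (Fin n)))
      (F' : EuclideanSpace ℝ (Fin n) → HolonomicApprox.JetFiber n q r),
      ContDiff ℝ ∞ φ ∧
      (∀ x, h x = HolonomicApprox.shear hk.le φ x) ∧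
      (∀ y, |φ y| < δ) ∧
      (∀ᶠ y in 𝓝ˢ (HolonomicApprox.cubeBoundary k k), φ y = 0) ∧
      h '' HolonomicApprox.cube n k ⊆ W ∧
      W ⊆ U ∧
      HolonomicApprox.IsHolonomicOn F' W ∧
      (∀ᶠ x in 𝓝ˢ (HolonomicApprox.cubeBoundary n k), F' x = F x) ∧
      ∃ ε' : ℝ, ε' < ε ∧ ∀ x ∈ W, ‖F' x - F x‖ ≤ ε' := by
  classical
  open HolonomicApprox in
  obtain ⟨V, hbV, -, hFV⟩ := hFhol
  obtain ⟨f₀, hf₀, V₀, hV₀, hbV₀, hFf₀⟩ :=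
    exists_contDiff_jet_eq (isCompact_cubeBoundary n k) hbV hFV
  obtain ⟨B, hB, hBU, ρ₀, g₀, S₀⟩ :=
    exists_fiberedApprox_zero hk hU hIU hF hf₀ hV₀ hbV₀ hFf₀ (e := ε / 4) (by linarith)
  obtain ⟨φ, ρ, g, S⟩ := exists_fiberedApprox hB S₀ le_rfl (half_pos hδ)
    (show ε / 4 < ε / 2 by linarith)
  have hρ := S.pos
  have hW : IsOpen (tube hk φ ρ) := isOpen_tube hk S.smooth_shift.continuous ρ
  -- At `j = k` the condition on the parameter is empty, so any value, here `0`, gives one map on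
  -- the whole tube.
  have hmem : ∀ x ∈ tube hk φ ρ, x ∈ subtube hk φ ρ k 0 := fun x hx =>
    ⟨hx, fun i hi hi' => absurd hi' (not_lt.2 hi)⟩
  have hg : ContDiffOn ℝ ∞ (g 0) (tube hk φ ρ) := (S.contDiffOn 0).mono hmem
  let F' : EuclideanSpace ℝ (Fin n) → JetFiber n q r := fun x =>
    if hx : x ∈ tube hk φ ρ then ⟨jet r (g 0) x, jet_mem_jetFiber r hW hg hx⟩ else F x
  have hF' : ∀ x ∈ tube hk φ ρ, (F' x : PreJet n q r) = jet r (g 0) x := fun x hx => by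
    simp only [F', hx, dif_pos]
  refine ⟨φ, shearDiffeomorph hk S.smooth_shift, tube hk φ ρ, F', S.smooth_shift, fun x => rfl,
    fun v => (S.abs_shift_le v).trans_lt (half_lt_self hδ), ?_, ?_, S.tube_subset.trans hBU,
    ⟨hW, g 0, hg, hF'⟩, ?_, ε / 2, half_lt_self hε, fun x hx => ?_⟩
  · exact Filter.mem_of_superset ((isOpen_nearFace k ρ).mem_nhdsSet.2 fun v hv =>
      nearFace_of_mem_cubeBoundary hρ hv) S.shift_eq_zero
  · rintro _ ⟨x, hx, rfl⟩
    exact shear_mem_tube hk hρ hx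
  -- The shift vanishes near the faces, so the shear fixes the boundary, which thus lies in the
  -- tube. On this open set `g 0` equals `f₀`, whose jet is `F`.
  · have hsub : cubeBoundary n k ⊆ tube hk φ ρ ∩ {x | NearFace k ρ x} ∩ V₀ := fun x hx => by
      have hf := nearFace_of_mem_cubeBoundary hρ hx
      refine ⟨⟨?_, hf⟩, hbV₀ hx⟩
      have h := shear_mem_tube hk (φ := φ) hρ hx.1
      have h0 := S.shift_eq_zero _ ((nearFace_firstCoords hk.le).2 hf)
      have h1 : shear hk.le φ x = x := by
        ext i
        simp [shear, h0]
      rwa [h1] at h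
    have hopen := (hW.inter (isOpen_nearFace k ρ))
    refine Filter.mem_of_superset ((hopen.inter hV₀).mem_nhdsSet.2 hsub) fun x hx => ?_
    refine Subtype.ext ?_
    rw [hF' x hx.1.1, ← hFf₀ x hx.2]
    refine jet_congr ?_
    filter_upwards [hopen.mem_nhds hx.1] with z hz
    exact S.eq_of_nearFace 0 z (hmem z hz.1) hz.2
  · have h := S.norm_sub_le 0 x (hmem x hx)
    rw [← hF' x hx] at h
    exact h
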